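/- **Setting.** Let $\mathcal E$ be a finite simple oriented plane graph, drawn in $\mathbb C$ with straight non-crossing oriented links (polygonal links are allowed by inserting vertices with one incoming and one outgoing link). A *circuit* is a nonempty closed walk that follows the orientations and uses each of its links exactly once (vertices may be revisited); a graph is *Eulerian* if it has a circuit through all its links. Assume that $\mathcal E$ is Eulerian and that its faces are two-coloured in accordance with the orientation: every link has a face of colour $+$ on its left and a face of colour $-$ on its right (so the links bordering a $+$ face run counter-clockwise around it, those bordering a $-$ face clockwise). For a circuit $C$ and a point $p$ off $C$, let $n(C,p)\in\mathbb Z$ be the winding number of $C$ around $p$. The points off $C$ with $n(C,p)\neq0$ are *inside* $C$, those with $n(C,p)=0$ are *outside*. Let $\mathcal C_1,\mathcal C_2$ be circuits of $\mathcal E$, each of which bounds the region inside it, either counter-clockwise ($n\in\{0,1\}$ everywhere off the circuit) or clockwise ($n\in\{0,-1\}$ everywhere off the circuit); every simple closed circuit is of this kind. Assume that they are nested: they share no link, and the inside of $\mathcal C_1$ is contained in the inside of $\mathcal C_2$. Let $D_1$ consist of the links of $\mathcal C_1$ and the links of $\mathcal E$ inside $\mathcal C_1$, let $D_2$ consist of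 the links of $\mathcal C_2$ and the links of $\mathcal E$ outside $\mathcal C_2$, and let the interface graph $\mathbf I$ consist of all other links of $\mathcal E$. Assume that $\mathbf I$ is Eulerian. Let $p$ be a point inside $\mathcal C_1$; the *central face* is the face of $\mathbf I$ that contains $p$. A *semi-infinite line* is a continuous curve $\gamma:[0,\infty)\to\mathbb C$, not necessarily straight, which starts in the central face, tends to infinity, and meets $\mathbf I$ finitely many times, each time by crossing a link, away from its end points, from one side to the other. A crossing from the left to the right of the oriented link counts $+1$, a crossing from its right to its left $-1$ (so a line going outwards counts $+1$ for a link running counter-clockwise around the central face). A circuit $S$ *surrounds* the central face counter-clockwise (resp. clockwise) if $n(S,p)>0$ (resp. $n(S,p)<0$). A *counter-clockwise (resp. clockwise) chiral interface mode* is a circuit $S$ of $\mathbf I$ that surrounds the central face counter-clockwise (resp. clockwise) and is not compensated: the links of $\mathbf I$ not in $S$ can be partitioned into circuits none of which surrounds the central face. **Theorem.** Semi-infinite lines exist, and the algebraic number $\mathcal W\in\mathbb Z$ of crossings of the links of $\mathbf I$ with a semi-infinite line is the same for all of them (the winding number of $\mathbf I$). Moreover: 1. $\mathbf I$ has a counter-clockwise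 (resp. clockwise) chiral interface mode if and only if $\mathcal W=+1$ (resp. $\mathcal W=-1$); 2. $\mathcal W=+1$ (resp. $\mathcal W=-1$) if and only if every decomposition of $\mathbf I$ into link-disjoint circuits contains a circuit that surrounds the central face counter-clockwise (resp. clockwise); 3. $\mathcal W=0$ if and only if $\mathbf I$ has no chiral interface mode of either orientation; 4. $\mathcal W=0$ if and only if $\mathcal C_1$ and $\mathcal C_2$ have opposite orientations. -/

import Mathlib

open scoped Topology ComplexConjugate

noncomputable section

namespace PlaneNetwork

/-- An oriented link drawn in the plane `ℂ`: the segment from `e.1` to `e.2`. A polygonal link is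
obtained by placing vertices with one incoming and one outgoing link along it. -/
abbrev Link : Type := ℂ × ℂ

/-- The closed segment occupied by a link. -/
def Link.seg (e : Link) : Set ℂ := segment ℝ e.1 e.2

/-- The open segment occupied by a link. -/
def Link.openSeg (e : Link) : Set ℂ := openSegment ℝ e.1 e.2

/-- Twice the signed area of the triangle `(e.1, e.2, z)`: positive when `z` lies to the left of
the oriented line through `e`, negative when it lies to the right. -/
def Link.side (e : Link) (z : ℂ) : ℝ := ((z - e.1) * conj (e.2 - e.1)).im

/-- The subset of the plane occupied by a finite set of links. -/
def trace (G : Finset Link) : Set ℂ := ⋃ e ∈ G, e.seg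

/-- The face of `G` that contains the point `p`. -/
def face (G : Finset Link) (p : ℂ) : Set ℂ := connectedComponentIn (trace G)ᶜ p

/-- A finite oriented plane graph, given by its links: no link is degenerate and two different
links meet at most at common end points (in particular the graph is simple). -/
structure IsPlaneGraph (G : Finset Link) : Prop where
  nondegenerate : ∀ e ∈ G, e.1 ≠ e.2
  planar : ∀ e ∈ G, ∀ f ∈ G, e ≠ f →
    e.seg ∩ f.seg ⊆ ({e.1, e.2} : Set ℂ) ∩ {f.1, f.2}

/-- `S` is the set of links of a circuit, that is, of a nonempty closed walk which follows the
orientation of the links and uses each of its links exactly once (vertices may be revisited). -/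
def IsCircuit (S : Finset Link) : Prop :=
  ∃ l : List Link, l ≠ [] ∧ l.Nodup ∧ l.toFinset = S ∧
    Cycle.Chain (fun e f : Link => e.2 = f.1) (l : Cycle Link)

/-- `G` has an Eulerian circuit. -/
def IsEulerian (G : Finset Link) : Prop := IsCircuit G

/-- The faces of `G` are coloured with two colours in accordance with the orientation of the links:
every link has a face of colour `+` (`true`) on its left and one of colour `-` (`false`) on its
right. So the links around a `+` face all run counter-clockwise around it, those around
a `-` face all run clockwise. -/
structure IsFaceColouring (G : Finset Link) (col : ℂ → Bool) : Prop where
  const_on_faces : ∀ p ∈ (trace G)ᶜ, ∀ q ∈ face G p, col q = col p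
  left_right : ∀ e ∈ G, ∀ z ∈ e.openSeg,
    ∀ᶠ w in 𝓝 z, (0 < e.side w → col w = true) ∧ (e.side w < 0 → col w = false)

/-- The winding number around `p` of a circuit with set of links `S` (for `p` off the circuit):
the total signed angle, divided by `2π`, under which its links are seen from `p`. -/
def windingAround (S : Finset Link) (p : ℂ) : ℝ :=
  (∑ e ∈ S, Complex.arg ((e.2 - p) / (e.1 - p))) / (2 * Real.pi)

/-- The region inside a circuit. -/
def inside (S : Finset Link) : Set ℂ := {p | p ∉ trace S ∧ windingAround S p ≠ 0}

/-- The region outside a circuit. -/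
def outside (S : Finset Link) : Set ℂ := {p | p ∉ trace S ∧ windingAround S p = 0}

/-- The circuit `S` bounds the region inside it, counter-clockwise. -/
def BoundsCCW (S : Finset Link) : Prop :=
  ∀ p ∉ trace S, windingAround S p = 0 ∨ windingAround S p = 1

/-- The circuit `S` bounds the region inside it, clockwise. -/
def BoundsCW (S : Finset Link) : Prop :=
  ∀ p ∉ trace S, windingAround S p = 0 ∨ windingAround S p = -1

/-- The interior domain `D₁`: the links of `C₁` and the links of `G` inside `C₁`. -/
def innerDomain (G C₁ : Finset Link) : Set Link :=
  {e | e ∈ C₁ ∨ (e ∈ G ∧ e.openSeg ⊆ inside C₁)}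

/-- The exterior domain `D₂`: the links of `C₂` and the links of `G` outside `C₂`. -/
def outerDomain (G C₂ : Finset Link) : Set Link :=
  {e | e ∈ C₂ ∨ (e ∈ G ∧ e.openSeg ⊆ outside C₂)}

open Classical in
/-- The interface graph: the links of `G` that belong neither to `D₁` nor to `D₂`. -/
def interfaceGraph (G C₁ C₂ : Finset Link) : Finset Link :=
  G.filter fun e => e ∉ innerDomain G C₁ ∧ e ∉ outerDomain G C₂

/-- An oriented Eulerian plane graph `G`, with its two-coloured faces, split by two nested
circuits `C₁` and `C₂` into an interior domain, an interface and an exterior domain, where the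
interface is itself an Eulerian graph. -/
structure IsNestedSplitting (G C₁ C₂ : Finset Link) : Prop where
  plane : IsPlaneGraph G
  eulerian : IsEulerian G
  coloured : ∃ col : ℂ → Bool, IsFaceColouring G col
  sub₁ : C₁ ⊆ G
  sub₂ : C₂ ⊆ G
  circuit₁ : IsCircuit C₁
  circuit₂ : IsCircuit C₂
  bounds₁ : BoundsCCW C₁ ∨ BoundsCW C₁
  bounds₂ : BoundsCCW C₂ ∨ BoundsCW C₂
  disjoint : Disjoint C₁ C₂
  nested : inside C₁ ⊆ inside C₂
  interface_eulerian : IsEulerian (interfaceGraph G C₁ C₂)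

/-- `C₁` and `C₂` have opposite orientations. -/
def OppositeOrientations (C₁ C₂ : Finset Link) : Prop :=
  (BoundsCCW C₁ ∧ BoundsCW C₂) ∨ (BoundsCW C₁ ∧ BoundsCCW C₂)

/-- At time `t` the line `γ` crosses the link `e` from its left to its right. A link that runs
counter-clockwise is crossed in this way by a line going outwards. -/
def CrossesPos (γ : ℝ → ℂ) (e : Link) (t : ℝ) : Prop :=
  γ t ∈ e.openSeg ∧ (∀ᶠ s in 𝓝[<] t, 0 < e.side (γ s)) ∧ ∀ᶠ s in 𝓝[>] t, e.side (γ s) < 0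

/-- At time `t` the line `γ` crosses the link `e` from its right to its left. -/
def CrossesNeg (γ : ℝ → ℂ) (e : Link) (t : ℝ) : Prop :=
  γ t ∈ e.openSeg ∧ (∀ᶠ s in 𝓝[<] t, e.side (γ s) < 0) ∧ ∀ᶠ s in 𝓝[>] t, 0 < e.side (γ s)

/-- `γ`, restricted to `[0, ∞)`, is a semi-infinite line, not necessarily straight, which starts in
the face of `I` that contains `p`, goes to infinity, and meets `I` finitely many times, each time
by crossing a link from one side to the other away from its end points. -/
structure IsSemiInfiniteLine (I : Finset Link) (p : ℂ) (γ : ℝ → ℂ) : Prop where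
  continuousOn : ContinuousOn γ (Set.Ici 0)
  to_infinity : Filter.Tendsto (fun t => ‖γ t‖) Filter.atTop Filter.atTop
  start : γ 0 ∈ face I p
  finite : {t : ℝ | 0 ≤ t ∧ γ t ∈ trace I}.Finite
  crosses : ∀ t : ℝ, 0 ≤ t → γ t ∈ trace I → ∃ e ∈ I, CrossesPos γ e t ∨ CrossesNeg γ e t

/-- The algebraic number of crossings of the oriented links of `I` with the line `γ`. -/
def signedCrossings (I : Finset Link) (γ : ℝ → ℂ) : ℤ :=
  ∑ e ∈ I, (({t : ℝ | 0 < t ∧ CrossesPos γ e t}.ncard : ℤ) -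
    ({t : ℝ | 0 < t ∧ CrossesNeg γ e t}.ncard : ℤ))

/-- `W` is the winding number of the graph `I` with respect to its face containing `p`: semi-infinite
lines exist, and the algebraic number of crossings is `W` for any of them. -/
def IsGraphWindingNumber (I : Finset Link) (p : ℂ) (W : ℤ) : Prop :=
  (∃ γ, IsSemiInfiniteLine I p γ) ∧ ∀ γ, IsSemiInfiniteLine I p γ → signedCrossings I γ = W

/-- `S` is a circuit that surrounds `p` counter-clockwise. -/
def SurroundsCCW (S : Finset Link) (p : ℂ) : Prop := IsCircuit S ∧ 0 < windingAround S p

/-- `S` is a circuit that surrounds `p` clockwise. -/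
def SurroundsCW (S : Finset Link) (p : ℂ) : Prop := IsCircuit S ∧ windingAround S p < 0

/-- The links of `L` can be distributed over link-disjoint circuits none of which surrounds `p`. -/
def DecomposesWithoutSurrounding (L : Finset Link) (p : ℂ) : Prop :=
  ∃ P : Finpartition L, ∀ S ∈ P.parts, IsCircuit S ∧ windingAround S p = 0

/-- A counter-clockwise chiral interface mode: a circuit of `I` that surrounds the face containing
`p` counter-clockwise and is not compensated, the rest of `I` being made of link-disjoint circuits
that do not surround this face. -/
def HasChiralModeCCW (I : Finset Link) (p : ℂ) : Prop :=
  ∃ S ⊆ I, SurroundsCCW S p ∧ DecomposesWithoutSurrounding (I \ S) p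

/-- A clockwise chiral interface mode. -/
def HasChiralModeCW (I : Finset Link) (p : ℂ) : Prop :=
  ∃ S ⊆ I, SurroundsCW S p ∧ DecomposesWithoutSurrounding (I \ S) p

/-- Every decomposition of `I` into link-disjoint circuits contains a circuit that surrounds `p`
counter-clockwise. -/
def EveryDecompositionCCW (I : Finset Link) (p : ℂ) : Prop :=
  ∀ P : Finpartition I, (∀ S ∈ P.parts, IsCircuit S) → ∃ S ∈ P.parts, SurroundsCCW S p

/-- Every decomposition of `I` into link-disjoint circuits contains a circuit that surrounds `p`
clockwise. -/
def EveryDecompositionCW (I : Finset Link) (p : ℂ) : Prop :=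
  ∀ P : Finpartition I, (∀ S ∈ P.parts, IsCircuit S) → ∃ S ∈ P.parts, SurroundsCW S p

end PlaneNetwork

end

open PlaneNetwork

open scoped Topology ComplexConjugate

namespace PlaneNetwork

open Filter

/-! ### Winding numbers of circuits -/

/-! The winding number of a circuit is an integer, is locally constant off the circuit, vanishes
near infinity and drops by one when a link is crossed from left to right. Since the interface is
itself a circuit, summing these drops along a semi-infinite line gives `windingAround I p`, whatever
the line (`IsSemiInfiniteLine.signedCrossings_eq`); a straight ray that avoids all vertices is such
a line.

The value at `p` comes from the face colouring. Let `κ` be 2 on `+` faces and 0 on `-` faces, and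
let `s₁`, `s₂` be the signs of the two circuits. Like twice a winding number, `κ` drops by 2 across
every link from left to right. Between the circuits every link belongs to the interface, so `2 *
windingAround I` and `κ` differ there by a constant. Just inside `C₂` one has `κ = 1 + s₂`, and just
outside `C₁` one has `κ = 1 - s₁`. The winding number of the interface is zero outside `C₂` and does
not change inside `C₁`, hence equals `((1 - s₁) - (1 + s₂)) / 2 = -(s₁ + s₂) / 2` there.
`IsNestedSplitting.two_mul_windingAround` turns this into one global identity, checked across each
link by `interface_jump_arith`.

Chiral modes and decompositions then only depend on the sign of this number: winding numbers add
over link-disjoint circuits, and the whole interface is one admissible circuit. -/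

theorem prod_snd_eq_of_isChain (f : ℂ → ℂ) (l : List Link) (a b : Link)
    (h : List.IsChain (fun e f : Link => e.2 = f.1) (a :: (l ++ [b]))) :
    ((a :: l).map fun e => f e.2).prod = (l.map fun e => f e.1).prod * f b.1 := by
  induction l generalizing a with
  | nil => simp_all
  | cons c l ih =>
    simp only [List.cons_append, List.isChain_cons_cons] at h
    have := ih c h.2
    simp only [List.map_cons, List.prod_cons] at this ⊢
    rw [this, h.1]
    ring

/-- Along a closed walk the heads of the links are their tails, shifted cyclically. This makes the
product of the ratios telescope to 1. -/
theorem IsCircuit.prod_fst_eq_prod_snd {S : Finset Link} (hS : IsCircuit S) (f : ℂ → ℂ) :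
    ∏ e ∈ S, f e.1 = ∏ e ∈ S, f e.2 := by
  obtain ⟨l, hl, hnd, rfl, hc⟩ := hS
  rw [List.prod_toFinset _ hnd, List.prod_toFinset _ hnd]
  cases l with
  | nil => simp at hl
  | cons a l =>
    rw [Cycle.chain_coe_cons] at hc
    rw [prod_snd_eq_of_isChain f l a a hc]
    simp [mul_comm]

/-! ### Segments and the angle under which a link is seen -/

theorem Link.left_mem_seg (e : Link) : e.1 ∈ e.seg := left_mem_segment ℝ _ _

theorem Link.right_mem_seg (e : Link) : e.2 ∈ e.seg := right_mem_segment ℝ _ _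

theorem Link.openSeg_subset_seg (e : Link) : e.openSeg ⊆ e.seg := openSegment_subset_segment ℝ _ _

theorem seg_subset_trace {S : Finset Link} {e : Link} (he : e ∈ S) : e.seg ⊆ trace S :=
  Set.subset_biUnion_of_mem (u := fun e : Link => e.seg) he

theorem mem_trace {S : Finset Link} {z : ℂ} : z ∈ trace S ↔ ∃ e ∈ S, z ∈ e.seg := by
  simp [trace]

theorem trace_mono {S T : Finset Link} (h : S ⊆ T) : trace S ⊆ trace T :=
  Set.biUnion_subset_biUnion_left h

theorem Link.isClosed_seg (e : Link) : IsClosed e.seg := by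
  have : e.seg = convexHull ℝ ({e.1, e.2} : Set ℂ) := (convexHull_pair _ _).symm
  rw [this]
  exact (Set.Finite.isCompact_convexHull ℝ (by simp)).isClosed

theorem isClosed_trace (S : Finset Link) : IsClosed (trace S) :=
  S.finite_toSet.isClosed_biUnion fun e _ => e.isClosed_seg

theorem Link.continuous_side (e : Link) : Continuous e.side := by
  unfold Link.side
  fun_prop

/-- The ratio whose argument is the angle under which a link is seen. -/
noncomputable def Link.ratio (e : Link) (z : ℂ) : ℂ := (e.2 - z) / (e.1 - z)

theorem Link.continuousAt_ratio {e : Link} {z : ℂ} (h : z ≠ e.1) : ContinuousAt e.ratio z := by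
  unfold Link.ratio
  exact ContinuousAt.div (by fun_prop) (by fun_prop) (sub_ne_zero.2 h.symm)

theorem Link.ratio_im {e : Link} (z : ℂ) :
    (e.ratio z).im = e.side z / Complex.normSq (e.1 - z) := by
  simp only [Link.ratio, Link.side, Complex.div_im, Complex.mul_im, Complex.conj_re,
    Complex.conj_im, Complex.sub_re, Complex.sub_im]
  ring

theorem Link.ratio_im_pos {e : Link} {z : ℂ} (h : 0 < e.side z) : 0 < (e.ratio z).im := by
  rw [Link.ratio_im]
  refine div_pos h (Complex.normSq_pos.2 fun h0 => ?_)
  rw [sub_eq_zero] at h0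
  simp [Link.side, h0] at h

theorem Link.ratio_im_neg {e : Link} {z : ℂ} (h : e.side z < 0) : (e.ratio z).im < 0 := by
  rw [Link.ratio_im]
  refine div_neg_of_neg_of_pos h (Complex.normSq_pos.2 fun h0 => ?_)
  rw [sub_eq_zero] at h0
  simp [Link.side, h0] at h

theorem Link.mem_seg_of_ratio {e : Link} {z : ℂ} (h1 : z ≠ e.1) (hre : (e.ratio z).re ≤ 0)
    (him : (e.ratio z).im = 0) : z ∈ e.seg := by
  have h0 : e.1 - z ≠ 0 := sub_ne_zero.2 h1.symm
  set r : ℝ := -(e.ratio z).re with hr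
  have hr0 : 0 ≤ r := by linarith
  have hrat : e.ratio z = ((-r : ℝ) : ℂ) := by
    apply Complex.ext <;> simp [hr, him]
  have hz : e.2 - z = -(r : ℂ) * (e.1 - z) := by
    rw [Link.ratio, div_eq_iff h0] at hrat
    simpa using hrat
  have hr1 : (1 + r) ≠ 0 := by positivity
  have hr1' : (1 + r : ℂ) ≠ 0 := by exact_mod_cast hr1
  -- Solving `e.2 - z = -r * (e.1 - z)` for `z` gives these weights.
  refine ⟨r / (1 + r), 1 / (1 + r), by positivity, by positivity, by field_simp; ring, ?_⟩
  simp only [Complex.real_smul]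
  push_cast
  field_simp
  linear_combination hz

/-- The branch cut of `arg` is met only on the link itself, so the angle is continuous elsewhere. -/
theorem Link.ratio_mem_slitPlane {e : Link} {z : ℂ} (h : z ∉ e.seg) :
    e.ratio z ∈ Complex.slitPlane := by
  have h1 : z ≠ e.1 := fun h' => h (h' ▸ e.left_mem_seg)
  rw [Complex.mem_slitPlane_iff]
  by_contra! hc
  exact h (Link.mem_seg_of_ratio h1 hc.1 hc.2)

/-- On the open link the ratio is a negative real, so the argument of its negative is continuous
there; this is what measures the jump. -/
theorem Link.neg_ratio_mem_slitPlane {e : Link} {z : ℂ} (hne : e.1 ≠ e.2) (h : z ∈ e.openSeg) :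
    z ≠ e.1 ∧ -e.ratio z ∈ Complex.slitPlane := by
  obtain ⟨a, b, ha, hb, hab, rfl⟩ := h
  have hab' : (a : ℂ) + b = 1 := by exact_mod_cast hab
  have hb0 : (b : ℂ) ≠ 0 := by exact_mod_cast hb.ne'
  have hd : e.1 - e.2 ≠ 0 := sub_ne_zero.2 hne
  have e1 : e.1 - (a • e.1 + b • e.2) = b * (e.1 - e.2) := by
    simp only [Complex.real_smul]
    linear_combination (-e.1) * hab'
  have e2 : e.2 - (a • e.1 + b • e.2) = -a * (e.1 - e.2) := by
    simp only [Complex.real_smul]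
    linear_combination (-e.2) * hab'
  constructor
  · intro h0
    rw [h0, sub_self] at e1
    exact mul_ne_zero hb0 hd e1.symm
  · rw [Link.ratio, e1, e2, mul_div_mul_right _ _ hd]
    have : -(-(a : ℂ) / b) = ((a / b : ℝ) : ℂ) := by push_cast; ring
    rw [this, Complex.ofReal_mem_slitPlane]
    positivity

/-! ### Integrality and local constancy of the winding number -/

theorem windingAround_eq (S : Finset Link) (z : ℂ) :
    windingAround S z = (∑ e ∈ S, (e.ratio z).arg) / (2 * Real.pi) := rfl

/-- The ratios multiply to 1, so the sum of their arguments is a multiple of `2π`. -/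
theorem IsCircuit.windingAround_mem_int {S : Finset Link} (hS : IsCircuit S) {z : ℂ}
    (hz : z ∉ trace S) : ∃ n : ℤ, windingAround S z = n := by
  have h1 : ∀ e ∈ S, e.1 - z ≠ 0 := fun e he h =>
    hz (seg_subset_trace he ((sub_eq_zero.1 h) ▸ e.left_mem_seg))
  have h2 : ∀ e ∈ S, e.2 - z ≠ 0 := fun e he h =>
    hz (seg_subset_trace he ((sub_eq_zero.1 h) ▸ e.right_mem_seg))
  have hprod : ∏ e ∈ S, e.ratio z = 1 := by
    simp only [Link.ratio]
    rw [Finset.prod_div_distrib, ← hS.prod_fst_eq_prod_snd fun w => w - z]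
    exact div_self (Finset.prod_ne_zero_iff.2 h1)
  have hexp : Complex.exp (∑ e ∈ S, ((e.ratio z).arg : ℂ) * Complex.I) = 1 := by
    rw [Complex.exp_sum]
    have : ∀ e ∈ S, Complex.exp ((e.ratio z).arg * Complex.I) = e.ratio z / ‖e.ratio z‖ := by
      intro e he
      have hne : e.ratio z ≠ 0 := div_ne_zero (h2 e he) (h1 e he)
      have hn : (‖e.ratio z‖ : ℂ) ≠ 0 := by exact_mod_cast norm_ne_zero_iff.2 hne
      rw [eq_div_iff hn, mul_comm]
      exact Complex.norm_mul_exp_arg_mul_I _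
    rw [Finset.prod_congr rfl this, Finset.prod_div_distrib, hprod, ← Complex.ofReal_prod,
      ← norm_prod, hprod]
    simp
  obtain ⟨n, hn⟩ := Complex.exp_eq_one_iff.1 hexp
  refine ⟨n, ?_⟩
  rw [← Finset.sum_mul, ← Complex.ofReal_sum] at hn
  have hn' : ((∑ e ∈ S, (e.ratio z).arg : ℝ) : ℂ) = ((n * (2 * Real.pi) : ℝ) : ℂ) := by
    apply mul_right_cancel₀ Complex.I_ne_zero
    rw [hn]; push_cast; ring
  rw [windingAround_eq, Complex.ofReal_injective hn', mul_div_cancel_right₀]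
  positivity

/-- Two integers less than 1 apart coincide. Integrality is required only pointwise, because winding
numbers are integers only off the circuit. -/
theorem eventually_eq_of_tendsto_of_int {α : Type*} {l : Filter α} {F : α → ℝ} {x : ℝ}
    (h : Tendsto F l (𝓝 x)) : ∀ᶠ z in l, (∃ n : ℤ, F z = n) → F z = round x := by
  have h1 : ∀ᶠ z in l, |F z - x| < 1 / 2 := by
    simpa [Real.dist_eq] using (Metric.tendsto_nhds.1 h) (1 / 2) (by norm_num)
  filter_upwards [h1] with z hz
  rintro ⟨n, hn⟩
  rw [hn] at hz ⊢
  have h2 := abs_sub_round x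
  have h3 : |((n - round x : ℤ) : ℝ)| < 1 := by
    push_cast
    calc |(n : ℝ) - round x| = |(n - x) + (x - round x)| := by ring_nf
      _ ≤ |(n : ℝ) - x| + |x - round x| := abs_add_le _ _
      _ < 1 := by linarith
  have h4 : |n - round x| < 1 := by exact_mod_cast h3
  have : n = round x := by rw [Int.abs_lt_one_iff] at h4; omega
  exact_mod_cast this

theorem continuousAt_windingAround {S : Finset Link} {z : ℂ} (hz : z ∉ trace S) :
    ContinuousAt (windingAround S) z := by
  have : windingAround S = fun z => (∑ e ∈ S, (e.ratio z).arg) / (2 * Real.pi) := rfl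
  rw [this]
  refine ContinuousAt.div_const (tendsto_finsetSum _ fun e he => ?_) _
  have he' : z ∉ e.seg := fun h => hz (seg_subset_trace he h)
  exact (Complex.continuousAt_arg (Link.ratio_mem_slitPlane he')).comp
    (Link.continuousAt_ratio fun h' => he' (h' ▸ e.left_mem_seg))

theorem IsCircuit.eventually_windingAround_eq {S : Finset Link} (hS : IsCircuit S) {z : ℂ}
    (hz : z ∉ trace S) : ∀ᶠ w in 𝓝 z, windingAround S w = windingAround S z := by
  have h := eventually_eq_of_tendsto_of_int (continuousAt_windingAround hz)
  have hz' := h.self_of_nhds (hS.windingAround_mem_int hz)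
  filter_upwards [h, (isClosed_trace S).isOpen_compl.mem_nhds hz] with w hw hw'
  rw [hz', hw (hS.windingAround_mem_int hw')]

theorem IsCircuit.windingAround_eq_zero_near_infinity {S : Finset Link} (hS : IsCircuit S) :
    ∀ᶠ z in cocompact ℂ, z ∉ trace S ∧ windingAround S z = 0 := by
  have hcpt : IsCompact (trace S) := S.finite_toSet.isCompact_biUnion fun e _ => by
    have : e.seg = convexHull ℝ ({e.1, e.2} : Set ℂ) := (convexHull_pair _ _).symm
    rw [this]
    exact Set.Finite.isCompact_convexHull ℝ (by simp)
  have hr : ∀ e : Link, Tendsto e.ratio (cocompact ℂ) (𝓝 1) := by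
    intro e
    have h1 : Tendsto (fun z : ℂ => e.1 - z) (cocompact ℂ) (cocompact ℂ) :=
      (Homeomorph.subLeft e.1).isClosedEmbedding.tendsto_cocompact
    -- The ratio equals `1 + (e.2 - e.1) / (e.1 - z)`.
    have h2 : Tendsto (fun z : ℂ => 1 + (e.2 - e.1) * (e.1 - z)⁻¹) (cocompact ℂ)
        (𝓝 (1 + (e.2 - e.1) * 0)) :=
      ((tendsto_inv₀_cobounded.mono_left (by rw [Metric.cobounded_eq_cocompact])).comp h1
        |>.const_mul _).const_add _
    simp only [mul_zero, add_zero] at h2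
    refine h2.congr' ?_
    filter_upwards [(isCompact_singleton (x := e.1)).compl_mem_cocompact] with z hz
    have : e.1 - z ≠ 0 := sub_ne_zero.2 fun h => hz h.symm
    rw [Link.ratio]
    field_simp
    ring
  have hw : Tendsto (windingAround S) (cocompact ℂ) (𝓝 0) := by
    have h0 : Tendsto (fun z => (∑ e ∈ S, (e.ratio z).arg) / (2 * Real.pi)) (cocompact ℂ)
        (𝓝 ((∑ _e ∈ S, Complex.arg 1) / (2 * Real.pi))) :=
      (tendsto_finsetSum _ fun e _ =>
        (Complex.continuousAt_arg Complex.one_mem_slitPlane).tendsto.comp (hr e)).div_const _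
    refine Tendsto.congr (fun z => (windingAround_eq S z).symm) ?_
    simpa using h0
  filter_upwards [eventually_eq_of_tendsto_of_int hw, hcpt.compl_mem_cocompact] with z h1 h2
  exact ⟨h2, by simpa using h1 (hS.windingAround_mem_int h2)⟩

/-! ### Plane graphs -/

theorem IsPlaneGraph.mono {G S : Finset Link} (hG : IsPlaneGraph G) (h : S ⊆ G) :
    IsPlaneGraph S :=
  ⟨fun e he => hG.1 e (h he), fun e he f hf => hG.2 e (h he) f (h hf)⟩

theorem Link.ne_of_mem_openSeg {e : Link} {z : ℂ} (hne : e.1 ≠ e.2) (h : z ∈ e.openSeg) :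
    z ≠ e.1 ∧ z ≠ e.2 := by
  refine ⟨(Link.neg_ratio_mem_slitPlane hne h).1, ?_⟩
  have h' : z ∈ Link.openSeg (e.2, e.1) := by
    rw [Link.openSeg, openSegment_symm]; exact h
  exact (Link.neg_ratio_mem_slitPlane (e := (e.2, e.1)) hne.symm h').1

theorem IsPlaneGraph.eq_of_mem_openSeg {G : Finset Link} (hG : IsPlaneGraph G) {e f : Link}
    (he : e ∈ G) (hf : f ∈ G) {z : ℂ} (hz : z ∈ e.openSeg) (hzf : z ∈ f.seg) : f = e := by
  by_contra hne
  have h1 := (hG.2 e he f hf (Ne.symm hne) ⟨e.openSeg_subset_seg hz, hzf⟩).1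
  have h2 := Link.ne_of_mem_openSeg (hG.1 e he) hz
  rcases h1 with h1 | h1
  · exact h2.1 h1
  · exact h2.2 h1

theorem IsPlaneGraph.notMem_trace {G S : Finset Link} (hG : IsPlaneGraph G) (hSG : S ⊆ G)
    {e : Link} (he : e ∈ G) (heS : e ∉ S) {z : ℂ} (hz : z ∈ e.openSeg) : z ∉ trace S := by
  rw [mem_trace]
  rintro ⟨f, hf, hzf⟩
  exact heS (hG.eq_of_mem_openSeg he (hSG hf) hz hzf ▸ hf)

theorem Link.side_add (e : Link) (z v : ℂ) :
    e.side (z + v) = e.side z + (v * conj (e.2 - e.1)).im := by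
  simp only [Link.side, ← Complex.add_im]
  congr 1; ring

theorem Link.side_add_normal (e : Link) (z : ℂ) (t : ℝ) :
    e.side (z + t * (Complex.I * (e.2 - e.1))) = e.side z + t * Complex.normSq (e.2 - e.1) := by
  rw [Link.side_add, mul_assoc, mul_assoc, Complex.mul_conj]
  simp

theorem Link.tendsto_normal (e : Link) (z : ℂ) :
    Tendsto (fun t : ℝ => z + t * (Complex.I * (e.2 - e.1))) (𝓝 0) (𝓝 z) := by
  have : Continuous fun t : ℝ => z + t * (Complex.I * (e.2 - e.1)) := by fun_prop
  simpa using this.tendsto 0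

theorem Link.side_eq_zero_of_mem_seg {e : Link} {z : ℂ} (h : z ∈ e.seg) : e.side z = 0 := by
  obtain ⟨a, b, ha, hb, hab, rfl⟩ := h
  have : a = 1 - b := by linarith
  subst this
  simp [Link.side]
  ring

/-! ### Generic points, off every line through a link -/

/-- The union of the lines through the links of `G`. -/
def lines (G : Finset Link) : Set ℂ := {z | ∃ e ∈ G, e.side z = 0}

theorem trace_subset_lines (G : Finset Link) : trace G ⊆ lines G := by
  intro z hz
  obtain ⟨e, he, h⟩ := mem_trace.1 hz
  exact ⟨e, he, Link.side_eq_zero_of_mem_seg h⟩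

/-- A finite intersection of dense open sets. At a generic point `side` is nonzero for every link,
so left and right are always decided. -/
theorem dense_compl_lines {G : Finset Link} (hG : ∀ e ∈ G, e.1 ≠ e.2) : Dense (lines G)ᶜ := by
  have hlines : (lines G)ᶜ = ⋂ e ∈ G, {z : ℂ | e.side z ≠ 0} := by
    ext z; simp [lines]
  rw [hlines]
  have hopen : ∀ e : Link, IsOpen {z : ℂ | e.side z ≠ 0} := fun e =>
    isOpen_ne_fun e.continuous_side continuous_const
  have hdense : ∀ e ∈ G, Dense {z : ℂ | e.side z ≠ 0} := by
    intro e he z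
    by_cases hz : e.side z ≠ 0
    · exact subset_closure hz
    push Not at hz
    have hd : e.2 - e.1 ≠ 0 := sub_ne_zero.2 (hG e he).symm
    refine mem_closure_of_tendsto ((e.tendsto_normal z).mono_left (nhdsWithin_le_nhds (s := {0}ᶜ))) ?_
    filter_upwards [self_mem_nhdsWithin] with t ht
    show e.side _ ≠ 0
    rw [Link.side_add_normal, hz, zero_add]
    exact mul_ne_zero ht (by simpa using hd)
  clear hlines hG
  induction G using Finset.induction_on with
  | empty => simp
  | insert e S _ ih =>
    rw [Finset.set_biInter_insert]
    exact (hdense e (by simp)).inter_of_isOpen_left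
      (ih fun f hf => hdense f (by simp [hf])) (hopen e)

/-- The jump of the winding number across a link. -/
theorem IsPlaneGraph.exists_windingAround_jump {G S : Finset Link} (hG : IsPlaneGraph G)
    (hS : IsCircuit S) (hSG : S ⊆ G) {e : Link} (he : e ∈ S) {z : ℂ} (hz : z ∈ e.openSeg) :
    ∃ n : ℤ, ∀ᶠ w in 𝓝 z, w ∉ trace S → (0 < e.side w → windingAround S w = n + 1) ∧
      (e.side w < 0 → windingAround S w = n) := by
  -- Replacing `arg` of the ratio by `arg` of its negative moves the branch cut away from the link,
  -- at the cost of half a turn. The shift by 1/2 makes `H` agree with the winding number on the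
  -- right and fall short of it by 1 on the left.
  set H : ℂ → ℝ := fun w => windingAround (S.erase e) w + (-e.ratio w).arg / (2 * Real.pi)
    - 1 / 2 with hH
  have hcont : ContinuousAt H z := by
    have h1 := Link.neg_ratio_mem_slitPlane (hG.1 e (hSG he)) hz
    refine ContinuousAt.sub (ContinuousAt.add (continuousAt_windingAround
      (hG.notMem_trace ((S.erase_subset e).trans hSG) (hSG he) (by simp) hz))
      (ContinuousAt.div_const ?_ _)) continuousAt_const
    exact (Complex.continuousAt_arg h1.2).comp (f := fun w => -e.ratio w)
      (Link.continuousAt_ratio h1.1).neg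
  have hpi := Real.pi_pos
  have hsum : ∀ w, windingAround S w = windingAround (S.erase e) w
      + (e.ratio w).arg / (2 * Real.pi) := by
    intro w
    rw [windingAround_eq, windingAround_eq, ← Finset.sum_erase_add _ _ he, add_div]
  have hpos : ∀ w, 0 < e.side w → windingAround S w = H w + 1 := by
    intro w hw
    rw [hsum, hH]
    simp only
    rw [Complex.arg_neg_eq_arg_sub_pi_of_im_pos (Link.ratio_im_pos hw)]
    field_simp
    ring
  have hneg : ∀ w, e.side w < 0 → windingAround S w = H w := by
    intro w hw
    rw [hsum, hH]
    simp only
    rw [Complex.arg_neg_eq_arg_add_pi_of_im_neg (Link.ratio_im_neg hw)]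
    field_simp
    ring
  refine ⟨round (H z), ?_⟩
  filter_upwards [eventually_eq_of_tendsto_of_int hcont] with w hw hwS
  obtain ⟨n, hn⟩ := hS.windingAround_mem_int hwS
  constructor
  · intro h
    rw [hpos w h, hw ⟨n - 1, by rw [hpos w h] at hn; push_cast; linarith⟩]
  · intro h
    rw [hneg w h, hw ⟨n, by rw [← hneg w h]; exact hn⟩]

/-! ### Locally constant functions -/

/-- The local constant of `F` off `B` is unique because `B` leaves points near everywhere, so it
defines a locally constant function on all of `A`. Values of `F` on `B` play no role. -/
theorem IsPreconnected.eq_of_eventually_const {X α : Type*} [TopologicalSpace X] {A B : Set X}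
    (hA : IsPreconnected A) (hB : ∀ x ∈ A, ∃ᶠ y in 𝓝[A] x, y ∉ B) {F : X → α}
    (hF : ∀ x ∈ A, ∃ c, ∀ᶠ y in 𝓝[A] x, y ∉ B → F y = c) {x y : X} (hx : x ∈ A) (hxB : x ∉ B)
    (hy : y ∈ A) (hyB : y ∉ B) : F x = F y := by
  classical
  let _ : TopologicalSpace α := ⊥
  have : DiscreteTopology α := ⟨rfl⟩
  have : Nonempty α := ⟨F x⟩
  choose! c hc using hF
  have hcont : ContinuousOn c A := by
    intro x hx
    have h : ∀ᶠ y in 𝓝[A] x, c y = c x := by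
      filter_upwards [eventually_eventually_nhdsWithin.2 (hc x hx), self_mem_nhdsWithin]
        with y hy hyA
      obtain ⟨z, ⟨hz1, hz2⟩, hz3⟩ := ((hB y hyA).and_eventually (hc y hyA)).and_eventually hy
        |>.exists
      rw [← hz2 hz1, hz3 hz1]
    exact (tendsto_const_nhds (x := c x)).congr' (h.mono fun _ h => h.symm)
  rw [(hc x hx).self_of_nhdsWithin hx hxB, (hc y hy).self_of_nhdsWithin hy hyB]
  exact hA.constant hcont hx hy

theorem IsCircuit.windingAround_eq_of_isPreconnected {S : Finset Link} (hS : IsCircuit S)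
    {A : Set ℂ} (hA : IsPreconnected A) (hAS : A ⊆ (trace S)ᶜ) {x y : ℂ} (hx : x ∈ A)
    (hy : y ∈ A) : windingAround S x = windingAround S y :=
  IsPreconnected.eq_of_eventually_const (B := ∅) hA
    (fun x hx => by
      have : (𝓝[A] x).NeBot := mem_closure_iff_nhdsWithin_neBot.1 (subset_closure hx)
      simpa using this)
    (fun x hx => ⟨_, nhdsWithin_le_nhds ((hS.eventually_windingAround_eq (hAS hx)).mono
      fun _ h _ => h)⟩) hx (by simp) hy (by simp)

/-! ### Semi-infinite lines -/

theorem eventually_nhdsNE_notMem_finset (T : Finset ℝ) (t : ℝ) : ∀ᶠ s in 𝓝[≠] t, s ∉ T := by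
  have h : (↑(T.erase t) : Set ℝ)ᶜ ∈ 𝓝 t :=
    (T.erase t).finite_toSet.isClosed.isOpen_compl.mem_nhds (by simp)
  filter_upwards [nhdsWithin_le_nhds h, self_mem_nhdsWithin] with s hs hst hsT
  exact hs (Finset.mem_coe.2 (Finset.mem_erase.2 ⟨hst, hsT⟩))

theorem eq_sum_of_jumps {T : Finset ℝ} (hT : ∀ t ∈ T, 0 < t) {g j : ℝ → ℝ}
    (hloc : ∀ t, 0 ≤ t → t ∉ T → ∀ᶠ s in 𝓝[Set.Ici 0] t, g s = g t)
    (hjump : ∀ t ∈ T, ∃ c, (∀ᶠ s in 𝓝[<] t, g s = c) ∧ ∀ᶠ s in 𝓝[>] t, g s = c - j t)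
    (hend : ∀ᶠ s in atTop, g s = 0) : g 0 = ∑ t ∈ T, j t := by
  -- Adding back each jump `j τ` after time `τ` makes the function constant off `T`; it is then
  -- compared at 0 and at a late time.
  set u : ℝ → ℝ → ℝ := fun τ s => if τ < s then j τ else 0 with hu
  have hconst : ∀ t τ, τ ≠ t → ∀ᶠ s in 𝓝 t, u τ s = u τ t := by
    intro t τ hne
    rcases lt_or_gt_of_ne hne with h | h
    · filter_upwards [lt_mem_nhds h] with s hs
      simp [hu, hs, h]
    · filter_upwards [gt_mem_nhds h] with s hs
      simp [hu, hs.not_gt, h.not_gt]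
  have hconst' : ∀ t (R : Finset ℝ), t ∉ R →
      ∀ᶠ s in 𝓝 t, ∑ τ ∈ R, u τ s = ∑ τ ∈ R, u τ t := by
    intro t R ht
    have : ∀ᶠ s in 𝓝 t, ∀ τ ∈ R, u τ s = u τ t :=
      (Finset.eventually_all R).2 fun τ hτ => hconst t τ fun h => ht (h ▸ hτ)
    filter_upwards [this] with s hs using Finset.sum_congr rfl hs
  obtain ⟨s, hs0, hs1, hs2⟩ := (hend.and ((eventually_gt_atTop 0).and
    ((Finset.eventually_all T).2 fun τ _ => eventually_gt_atTop τ))).exists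
  have key := IsPreconnected.eq_of_eventually_const (A := Set.Ici (0 : ℝ)) (B := (T : Set ℝ))
    (F := fun s => g s + ∑ τ ∈ T, u τ s) isPreconnected_Ici
    (fun t ht => by
      have h : ∀ᶠ s in 𝓝[>] t, s ∉ T :=
        (eventually_nhdsNE_notMem_finset T t).filter_mono (nhdsWithin_mono _ fun s hs => ne_of_gt hs)
      exact h.frequently.filter_mono
        (nhdsWithin_mono _ fun s (hs : t < s) => (le_trans ht hs.le : (0 : ℝ) ≤ s)))
    (fun t ht => by
      by_cases htT : t ∈ T
      · obtain ⟨c, hc1, hc2⟩ := hjump t htT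
        refine ⟨c + ∑ τ ∈ T.erase t, u τ t, ?_⟩
        filter_upwards [nhdsWithin_le_nhds (hconst' t (T.erase t) (by simp)),
          nhdsWithin_le_nhds (eventually_nhdsWithin_iff.1 hc1),
          nhdsWithin_le_nhds (eventually_nhdsWithin_iff.1 hc2)] with s h1 h2 h3 hsT
        rw [← Finset.sum_erase_add _ _ htT, h1]
        rcases lt_trichotomy s t with h | h | h
        · rw [h2 h]; simp [hu, h.not_gt]
        · exact absurd (h ▸ htT) hsT
        · rw [h3 h]; simp only [hu, if_pos h]; ring
      · refine ⟨g t + ∑ τ ∈ T, u τ t, ?_⟩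
        filter_upwards [hloc t ht htT, nhdsWithin_le_nhds (hconst' t T htT)] with s h1 h2 _
        rw [h1, h2])
    (x := 0) (y := s) (by simp) (fun h => (hT 0 h).false) hs1.le (fun h => (hs2 s h).false)
  have h0 : ∑ τ ∈ T, u τ 0 = 0 := Finset.sum_eq_zero fun τ hτ => by simp [hu, (hT τ hτ).not_gt]
  have hs' : ∑ τ ∈ T, u τ s = ∑ τ ∈ T, j τ :=
    Finset.sum_congr rfl fun τ hτ => by simp [hu, hs2 τ hτ]
  simpa [h0, hs', hs0] using key

theorem CrossesPos.not_crossesNeg {γ : ℝ → ℂ} {e : Link} {t : ℝ} (h : CrossesPos γ e t) :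
    ¬ CrossesNeg γ e t := fun h' => by
  obtain ⟨s, h1, h2⟩ := (h.2.1.and h'.2.1).exists
  exact lt_asymm h1 h2

theorem IsSemiInfiniteLine.signedCrossings_eq {I : Finset Link} (hI : IsPlaneGraph I)
    (hc : IsCircuit I) {p : ℂ} {γ : ℝ → ℂ} (hγ : IsSemiInfiniteLine I p γ)
    (hp : p ∉ trace I) : (signedCrossings I γ : ℝ) = windingAround I p := by
  classical
  have hface : face I p ⊆ (trace I)ᶜ := connectedComponentIn_subset _ _
  have hstart : windingAround I (γ 0) = windingAround I p :=
    hc.windingAround_eq_of_isPreconnected isPreconnected_connectedComponentIn hface hγ.start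
      (mem_connectedComponentIn hp)
  set T := hγ.finite.toFinset with hTdef
  have memT : ∀ t, t ∈ T ↔ 0 ≤ t ∧ γ t ∈ trace I := fun t => by simp [hTdef]
  have hT : ∀ t ∈ T, 0 < t := by
    intro t ht
    rw [memT] at ht
    refine lt_of_le_of_ne ht.1 fun h => ?_
    rw [← h] at ht
    exact hface hγ.start ht.2
  set j : ℝ → ℤ := fun t => ∑ e ∈ I, ((if CrossesPos γ e t then 1 else 0) -
    (if CrossesNeg γ e t then 1 else 0)) with hj
  have hmem : ∀ e ∈ I, ∀ t, 0 < t → γ t ∈ e.openSeg → t ∈ T := fun e he t ht h =>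
    (memT t).2 ⟨ht.le, seg_subset_trace he (e.openSeg_subset_seg h)⟩
  have hcross : signedCrossings I γ = ∑ t ∈ T, j t := by
    rw [hj, Finset.sum_comm, signedCrossings]
    refine Finset.sum_congr rfl fun e he => ?_
    have h1 : {t : ℝ | 0 < t ∧ CrossesPos γ e t} = ↑(T.filter (CrossesPos γ e)) := by
      ext t
      simp only [Set.mem_ofPred_eq, Finset.coe_filter]
      exact ⟨fun h => ⟨hmem e he t h.1 h.2.1, h.2⟩, fun h => ⟨hT t h.1, h.2⟩⟩
    have h2 : {t : ℝ | 0 < t ∧ CrossesNeg γ e t} = ↑(T.filter (CrossesNeg γ e)) := by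
      ext t
      simp only [Set.mem_ofPred_eq, Finset.coe_filter]
      exact ⟨fun h => ⟨hmem e he t h.1 h.2.1, h.2⟩, fun h => ⟨hT t h.1, h.2⟩⟩
    rw [h1, h2, Set.ncard_coe_finset, Set.ncard_coe_finset, Finset.sum_sub_distrib]
    simp
  -- By planarity only one link is crossed at a given time.
  have hj_eq : ∀ t, ∀ e ∈ I, γ t ∈ e.openSeg →
      j t = (if CrossesPos γ e t then 1 else 0) - (if CrossesNeg γ e t then 1 else 0) := by
    intro t e he h
    refine Finset.sum_eq_single e (fun f hf hne => ?_) (fun h' => absurd he h')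
    have hnot : γ t ∉ f.openSeg := fun h' =>
      hne (hI.eq_of_mem_openSeg he hf h (f.openSeg_subset_seg h'))
    rw [if_neg fun h' : CrossesPos γ f t => hnot h'.1,
      if_neg fun h' : CrossesNeg γ f t => hnot h'.1, sub_zero]
  rw [hcross, ← hstart]
  push_cast
  symm
  refine eq_sum_of_jumps (g := fun t => windingAround I (γ t)) hT ?_ ?_ ?_
  · intro t ht htT
    have : γ t ∉ trace I := fun h => htT ((memT t).2 ⟨ht, h⟩)
    exact (hγ.continuousOn t ht).eventually (hc.eventually_windingAround_eq this)
  · intro t ht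
    have hcont : ContinuousAt γ t := hγ.continuousOn.continuousAt (Ici_mem_nhds (hT t ht))
    have hoff : ∀ᶠ s in 𝓝[≠] t, γ s ∉ trace I := by
      filter_upwards [eventually_nhdsNE_notMem_finset T t,
        nhdsWithin_le_nhds (lt_mem_nhds (hT t ht))] with s h1 h2 h3
      exact h1 ((memT s).2 ⟨h2.le, h3⟩)
    have hoffl : ∀ᶠ s in 𝓝[<] t, γ s ∉ trace I :=
      hoff.filter_mono (nhdsWithin_mono _ fun s hs => ne_of_lt hs)
    have hoffr : ∀ᶠ s in 𝓝[>] t, γ s ∉ trace I :=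
      hoff.filter_mono (nhdsWithin_mono _ fun s hs => ne_of_gt hs)
    obtain ⟨e, he, hcr⟩ := hγ.crosses t (hT t ht).le ((memT t).1 ht).2
    have hopen : γ t ∈ e.openSeg := hcr.elim (·.1) (·.1)
    obtain ⟨n, hn⟩ := hI.exists_windingAround_jump hc subset_rfl he hopen
    have hn' := hcont.eventually hn
    rcases hcr with hcr | hcr
    · refine ⟨n + 1, ?_, ?_⟩
      · filter_upwards [hoffl, nhdsWithin_le_nhds hn', hcr.2.1] with s h1 h2 h3
        exact (h2 h1).1 h3
      · filter_upwards [hoffr, nhdsWithin_le_nhds hn', hcr.2.2] with s h1 h2 h3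
        rw [(h2 h1).2 h3, hj_eq t e he hopen, if_pos hcr, if_neg hcr.not_crossesNeg]
        simp
    · refine ⟨n, ?_, ?_⟩
      · filter_upwards [hoffl, nhdsWithin_le_nhds hn', hcr.2.1] with s h1 h2 h3
        exact (h2 h1).2 h3
      · filter_upwards [hoffr, nhdsWithin_le_nhds hn', hcr.2.2] with s h1 h2 h3
        rw [(h2 h1).1 h3, hj_eq t e he hopen, if_pos hcr,
          if_neg fun h : CrossesPos γ e t => h.not_crossesNeg hcr]
        simp
  · have : Tendsto γ atTop (cocompact ℂ) := by
      rw [← Metric.cobounded_eq_cocompact, ← tendsto_norm_atTop_iff_cobounded]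
      exact hγ.to_infinity
    exact this.eventually (hc.windingAround_eq_zero_near_infinity.mono fun _ h => h.2)

/-- The direction `1 + s * I` works for every slope `s` outside finitely many values. A point `v`
vertically above or below `p` is never hit. -/
theorem exists_direction (V : Finset ℂ) {p : ℂ} (hp : p ∉ V) :
    ∃ u : ℂ, u ≠ 0 ∧ ∀ v ∈ V, ((v - p) * conj u).im ≠ 0 := by
  obtain ⟨s, hs⟩ := Infinite.exists_notMem_finset
    (V.image fun v => (v - p).im / (v - p).re)
  refine ⟨⟨1, s⟩, fun h => by simpa using congrArg Complex.re h, fun v hv h => ?_⟩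
  simp only [Complex.mul_im, Complex.conj_re, Complex.conj_im] at h
  by_cases hre : (v - p).re = 0
  · have him : (v - p).im = 0 := by rw [hre] at h; linarith
    exact hp ((sub_eq_zero.1 (Complex.ext hre him)) ▸ hv)
  · refine hs (Finset.mem_image.2 ⟨v, hv, ?_⟩)
    rw [div_eq_iff hre]
    linarith

theorem exists_isSemiInfiniteLine {I : Finset Link} {p : ℂ}
    (hp : p ∉ trace I) : ∃ γ, IsSemiInfiniteLine I p γ := by
  classical
  obtain ⟨u, hu0, hu⟩ := exists_direction (I.image Prod.fst ∪ I.image Prod.snd) (p := p) (by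
    intro h
    simp only [Finset.mem_union, Finset.mem_image] at h
    rcases h with ⟨e, he, rfl⟩ | ⟨e, he, rfl⟩
    · exact hp (seg_subset_trace he (Link.left_mem_seg e))
    · exact hp (seg_subset_trace he (Link.right_mem_seg e)))
  have hu1 : ∀ e ∈ I, ((e.1 - p) * conj u).im ≠ 0 := fun e he =>
    hu _ (Finset.mem_union_left _ (Finset.mem_image_of_mem _ he))
  have hu2 : ∀ e ∈ I, ((e.2 - p) * conj u).im ≠ 0 := fun e he =>
    hu _ (Finset.mem_union_right _ (Finset.mem_image_of_mem _ he))
  set γ : ℝ → ℂ := fun t => p + t * u with hγ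
  have hcont : Continuous γ := by fun_prop
  have hoff : ∀ (z : ℂ) (t : ℝ), ((z - p) * conj u).im ≠ 0 → γ t ≠ z := by
    rintro z t hz rfl
    apply hz
    simp only [hγ, add_sub_cancel_left, mul_assoc, Complex.mul_conj]
    simp
  have hopen : ∀ e ∈ I, ∀ t, γ t ∈ e.seg → γ t ∈ e.openSeg := fun e he t ht =>
    mem_openSegment_of_ne_left_right (hoff _ t (hu1 e he)).symm (hoff _ t (hu2 e he)).symm ht
  have hside : ∀ (e : Link) (t s : ℝ),
      e.side (γ s) = e.side (γ t) + (s - t) * (u * conj (e.2 - e.1)).im := by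
    intro e t s
    have : γ s = γ t + ((s - t : ℝ) : ℂ) * u := by simp only [hγ]; push_cast; ring
    rw [this, Link.side_add, mul_assoc, Complex.im_ofReal_mul]
  -- A link met by the ray and parallel to it would have its end points on the line of the ray,
  -- which `u` excludes.
  have hslope : ∀ e ∈ I, ∀ t, γ t ∈ e.seg → (u * conj (e.2 - e.1)).im ≠ 0 := by
    intro e he t ht h
    obtain ⟨a, b, ha, hb, hab, hz⟩ := ht
    apply hu1 e he
    have hz' : e.1 - p = t * u - b * (e.2 - e.1) := by
      have hab' : (a : ℂ) + b = 1 := by exact_mod_cast hab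
      simp only [hγ, Complex.real_smul] at hz
      linear_combination (-e.1) * hab' + hz
    have h' : ((e.2 - e.1) * conj u).im = 0 := by
      simp only [Complex.mul_im, Complex.conj_re, Complex.conj_im] at h ⊢
      linarith
    rw [hz', sub_mul, mul_assoc, mul_assoc, Complex.mul_conj, Complex.sub_im,
      Complex.im_ofReal_mul, Complex.im_ofReal_mul, h']
    simp
  refine ⟨γ, hcont.continuousOn, ?_, ?_, ?_, ?_⟩
  · have h1 : Tendsto (fun t : ℝ => t * ‖u‖ - ‖p‖) atTop atTop :=
      tendsto_atTop_add_const_right _ _ (tendsto_id.atTop_mul_const (norm_pos_iff.2 hu0))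
    refine tendsto_atTop_mono (fun t => ?_) h1
    have h2 : ‖(t : ℂ) * u‖ ≤ ‖γ t‖ + ‖p‖ := by
      have : (t : ℂ) * u = γ t - p := by simp [hγ]
      rw [this]
      exact norm_sub_le _ _
    rw [norm_mul, Complex.norm_real] at h2
    nlinarith [norm_nonneg u, le_abs_self t, Real.norm_eq_abs t,
      mul_le_mul_of_nonneg_right (le_abs_self t) (norm_nonneg u)]
  · have : γ 0 = p := by simp [hγ]
    rw [this]
    exact mem_connectedComponentIn hp
  · have hsub : {t : ℝ | 0 ≤ t ∧ γ t ∈ trace I} ⊆ ⋃ e ∈ I, {t | γ t ∈ e.seg} := by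
      rintro t ⟨_, ht⟩
      simpa using mem_trace.1 ht
    refine Set.Finite.subset (I.finite_toSet.biUnion fun e he => ?_) hsub
    refine Set.Subsingleton.finite fun t ht s hs => ?_
    have h := hside e t s
    rw [Link.side_eq_zero_of_mem_seg ht, Link.side_eq_zero_of_mem_seg hs, zero_add] at h
    have := (mul_eq_zero.1 h.symm).resolve_right (hslope e he t ht)
    linarith
  · intro t _ ht
    obtain ⟨e, he, hte⟩ := mem_trace.1 ht
    refine ⟨e, he, ?_⟩
    have h0 := Link.side_eq_zero_of_mem_seg hte
    rcases lt_or_gt_of_ne (hslope e he t hte) with h | h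
    · refine Or.inl ⟨hopen e he t hte, ?_, ?_⟩
      · filter_upwards [self_mem_nhdsWithin] with s hs
        rw [hside e t s, h0, zero_add]
        exact mul_pos_of_neg_of_neg (sub_neg.2 hs) h
      · filter_upwards [self_mem_nhdsWithin] with s hs
        rw [hside e t s, h0, zero_add]
        exact mul_neg_of_pos_of_neg (sub_pos.2 hs) h
    · refine Or.inr ⟨hopen e he t hte, ?_, ?_⟩
      · filter_upwards [self_mem_nhdsWithin] with s hs
        rw [hside e t s, h0, zero_add]
        exact mul_neg_of_neg_of_pos (sub_neg.2 hs) h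
      · filter_upwards [self_mem_nhdsWithin] with s hs
        rw [hside e t s, h0, zero_add]
        exact mul_pos (sub_pos.2 hs) h

/-! ### The winding number of the interface -/

theorem frequently_side_pos {G : Finset Link} (hG : ∀ e ∈ G, e.1 ≠ e.2) {e : Link} (he : e ∈ G)
    {z : ℂ} (hz : e.side z = 0) : ∃ᶠ w in 𝓝 z, w ∉ lines G ∧ 0 < e.side w := by
  have hd : 0 < Complex.normSq (e.2 - e.1) := Complex.normSq_pos.2 (sub_ne_zero.2 (hG e he).symm)
  have h1 : z ∈ closure {w | 0 < e.side w} := by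
    refine mem_closure_of_tendsto ((e.tendsto_normal z).mono_left
      (nhdsWithin_le_nhds (s := Set.Ioi 0))) ?_
    filter_upwards [self_mem_nhdsWithin] with t ht
    show 0 < e.side _
    rw [Link.side_add_normal, hz, zero_add]
    exact mul_pos ht hd
  have h2 := closure_minimal ((dense_compl_lines hG).open_subset_closure_inter
    (isOpen_lt continuous_const e.continuous_side)) isClosed_closure h1
  exact (mem_closure_iff_frequently.1 h2).mono fun w hw => ⟨hw.2, hw.1⟩

theorem frequently_side_neg {G : Finset Link} (hG : ∀ e ∈ G, e.1 ≠ e.2) {e : Link} (he : e ∈ G)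
    {z : ℂ} (hz : e.side z = 0) : ∃ᶠ w in 𝓝 z, w ∉ lines G ∧ e.side w < 0 := by
  have hd : 0 < Complex.normSq (e.2 - e.1) := Complex.normSq_pos.2 (sub_ne_zero.2 (hG e he).symm)
  have h1 : z ∈ closure {w | e.side w < 0} := by
    refine mem_closure_of_tendsto ((e.tendsto_normal z).mono_left
      (nhdsWithin_le_nhds (s := Set.Iio 0))) ?_
    filter_upwards [self_mem_nhdsWithin] with t ht
    show e.side _ < 0
    rw [Link.side_add_normal, hz, zero_add]
    exact mul_neg_of_neg_of_pos ht hd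
  have h2 := closure_minimal ((dense_compl_lines hG).open_subset_closure_inter
    (isOpen_lt e.continuous_side continuous_const)) isClosed_closure h1
  exact (mem_closure_iff_frequently.1 h2).mono fun w hw => ⟨hw.2, hw.1⟩

-- Here `n` is the value on the right of the link. For a link off `S` it is the value along the
-- whole open link, which decides whether the link is inside or outside.
open Classical in
theorem IsPlaneGraph.exists_windingAround_near_link {G S : Finset Link} (hG : IsPlaneGraph G)
    (hS : IsCircuit S) (hSG : S ⊆ G) {e : Link} (he : e ∈ G) {z : ℂ} (hz : z ∈ e.openSeg) :
    ∃ n : ℤ, (∀ᶠ w in 𝓝 z, w ∉ lines G →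
      (0 < e.side w → windingAround S w = (n + if e ∈ S then 1 else 0 : ℤ)) ∧
      (e.side w < 0 → windingAround S w = n)) ∧
      (e ∉ S → ∀ y ∈ e.openSeg, y ∉ trace S ∧ windingAround S y = n) := by
  by_cases heS : e ∈ S
  · obtain ⟨n, hn⟩ := hG.exists_windingAround_jump hS hSG heS hz
    refine ⟨n, ?_, fun h => absurd heS h⟩
    filter_upwards [hn] with w hw hwl
    simpa [heS] using hw fun h => hwl (trace_subset_lines G (trace_mono hSG h))
  · have hzS := hG.notMem_trace hSG he heS hz
    obtain ⟨n, hn⟩ := hS.windingAround_mem_int hzS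
    refine ⟨n, ?_, fun _ y hy => ⟨hG.notMem_trace hSG he heS hy, ?_⟩⟩
    · filter_upwards [hS.eventually_windingAround_eq hzS] with w hw _
      simp [heS, hw, hn]
    · rw [← hn]
      exact hS.windingAround_eq_of_isPreconnected (convex_openSegment _ _).isPreconnected
        (fun x hx => hG.notMem_trace hSG he heS hx) hy hz

/-- Right-hand values are `n₁`, `n₂`, left-hand values `n₁ + k₁`, `n₂ + k₂`, and the colour term is
2 on the left and 0 on the right. The hypotheses encode disjointness, nesting and membership in the
interface; the rest is a finite case check. -/
theorem interface_jump_arith {s₁ s₂ n₁ n₂ k k₁ k₂ : ℤ} (hs₁ : s₁ = 1 ∨ s₁ = -1)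
    (hs₂ : s₂ = 1 ∨ s₂ = -1) (hk₁ : k₁ = 0 ∨ k₁ = 1) (hk₂ : k₂ = 0 ∨ k₂ = 1)
    (hk₁₂ : k₁ = 0 ∨ k₂ = 0) (r₁ : n₁ = 0 ∨ n₁ = s₁) (r₂ : n₂ = 0 ∨ n₂ = s₂)
    (l₁ : n₁ + k₁ = 0 ∨ n₁ + k₁ = s₁) (l₂ : n₂ + k₂ = 0 ∨ n₂ + k₂ = s₂)
    (r : n₁ ≠ 0 → n₂ ≠ 0) (l : n₁ + k₁ ≠ 0 → n₂ + k₂ ≠ 0)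
    (hk : (k = 1 ∧ k₁ = 0 ∧ k₂ = 0 ∧ n₁ = 0 ∧ n₂ ≠ 0) ∨
      (k = 0 ∧ ¬ (k₁ = 0 ∧ k₂ = 0 ∧ n₁ = 0 ∧ n₂ ≠ 0))) :
    2 * k = (s₂ * (n₂ + k₂) * (2 - (1 + s₂)) - s₁ * (n₁ + k₁) * (2 - (1 - s₁))) -
      (s₂ * n₂ * (0 - (1 + s₂)) - s₁ * n₁ * (0 - (1 - s₁))) := by
  rcases hs₁ with rfl | rfl <;> rcases hs₂ with rfl | rfl <;> omega

theorem mem_interfaceGraph {G C₁ C₂ : Finset Link} {e : Link} :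
    e ∈ interfaceGraph G C₁ C₂ ↔ e ∈ G ∧ e ∉ C₁ ∧ e ∉ C₂ ∧ ¬ e.openSeg ⊆ inside C₁ ∧
      ¬ e.openSeg ⊆ outside C₂ := by
  classical
  rw [interfaceGraph, Finset.mem_filter]
  simp only [innerDomain, outerDomain, Set.mem_ofPred_eq]
  tauto

theorem interfaceGraph_subset (G C₁ C₂ : Finset Link) : interfaceGraph G C₁ C₂ ⊆ G :=
  fun _ he => (mem_interfaceGraph.1 he).1

theorem Link.openSeg_nonempty (e : Link) : e.openSeg.Nonempty :=
  ⟨_, 1 / 2, 1 / 2, by norm_num, by norm_num, by norm_num, rfl⟩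

theorem Link.openSeg_subset_inside_iff {e : Link} {S : Finset Link} {n : ℤ}
    (h : ∀ y ∈ e.openSeg, y ∉ trace S ∧ windingAround S y = n) :
    e.openSeg ⊆ inside S ↔ n ≠ 0 := by
  constructor
  · intro hsub
    obtain ⟨z, hz⟩ := e.openSeg_nonempty
    have h1 := (hsub hz).2
    rw [(h z hz).2] at h1
    exact_mod_cast h1
  · intro h0 y hy
    refine ⟨(h y hy).1, ?_⟩
    rw [(h y hy).2]
    exact_mod_cast h0

theorem Link.openSeg_subset_outside_iff {e : Link} {S : Finset Link} {n : ℤ}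
    (h : ∀ y ∈ e.openSeg, y ∉ trace S ∧ windingAround S y = n) :
    e.openSeg ⊆ outside S ↔ n = 0 := by
  constructor
  · intro hsub
    obtain ⟨z, hz⟩ := e.openSeg_nonempty
    have h1 := (hsub hz).2
    rw [(h z hz).2] at h1
    exact_mod_cast h1
  · intro h0 y hy
    refine ⟨(h y hy).1, ?_⟩
    rw [(h y hy).2]
    exact_mod_cast h0

theorem IsNestedSplitting.notMem_trace_interfaceGraph {G C₁ C₂ : Finset Link}
    (h : IsNestedSplitting G C₁ C₂) {p : ℂ} (hp : p ∈ inside C₁) :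
    p ∉ trace (interfaceGraph G C₁ C₂) := by
  rw [mem_trace]
  rintro ⟨e, he, hpe⟩
  obtain ⟨heG, he₁, -, hin, -⟩ := mem_interfaceGraph.1 he
  -- `p` could be an end point of the link, so a nearby point of the open link is used.
  have hcl : p ∈ closure e.openSeg := by
    rw [Link.openSeg, closure_openSegment]; exact hpe
  obtain ⟨y, hy, hyw⟩ := ((mem_closure_iff_frequently.1 hcl).and_eventually
    (h.circuit₁.eventually_windingAround_eq hp.1)).exists
  have hoff : e.openSeg ⊆ (trace C₁)ᶜ := fun x hx => h.plane.notMem_trace h.sub₁ heG he₁ hx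
  refine hin fun x hx => ⟨hoff hx, ?_⟩
  rw [h.circuit₁.windingAround_eq_of_isPreconnected (convex_openSegment _ _).isPreconnected
    hoff hx hy, hyw]
  exact hp.2

open Classical in
theorem IsNestedSplitting.two_mul_windingAround {G C₁ C₂ : Finset Link}
    (h : IsNestedSplitting G C₁ C₂) {s₁ s₂ : ℤ} (hs₁ : s₁ = 1 ∨ s₁ = -1)
    (hs₂ : s₂ = 1 ∨ s₂ = -1)
    (b₁ : ∀ w ∉ trace C₁, windingAround C₁ w = 0 ∨ windingAround C₁ w = s₁)
    (b₂ : ∀ w ∉ trace C₂, windingAround C₂ w = 0 ∨ windingAround C₂ w = s₂)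
    {p : ℂ} (hp : p ∈ inside C₁) :
    2 * windingAround (interfaceGraph G C₁ C₂) p = -(s₁ + s₂) := by
  obtain ⟨col, hcol⟩ := h.coloured
  set I := interfaceGraph G C₁ C₂ with hI
  have hIG : I ⊆ G := interfaceGraph_subset G C₁ C₂
  have hIc : IsCircuit I := h.interface_eulerian
  have off : ∀ {S : Finset Link}, S ⊆ G → ∀ {w}, w ∉ lines G → w ∉ trace S :=
    fun hS w hw hw' => hw (trace_subset_lines G (trace_mono hS hw'))
  have nest : ∀ {w}, w ∉ lines G → windingAround C₁ w ≠ 0 → windingAround C₂ w ≠ 0 :=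
    fun hw hw₁ => (h.nested ⟨off h.sub₁ hw, hw₁⟩).2
  set κ : ℂ → ℝ := fun w => if col w = true then 2 else 0 with hκ
  -- `s₁ * windingAround C₁` and `s₂ * windingAround C₂` are the indicators of the two insides. The
  -- offsets `1 + s₂` and `1 - s₁` are the values of `κ` just inside `C₂` and just outside `C₁`, so
  -- that neither circuit makes `F` jump.
  set F : ℂ → ℝ := fun w => 2 * windingAround I w -
    (s₂ * windingAround C₂ w * (κ w - (1 + s₂)) - s₁ * windingAround C₁ w * (κ w - (1 - s₁)))
    with hF
  set V : Finset ℂ := G.image Prod.fst ∪ G.image Prod.snd with hV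
  have hVopen : IsOpen (V : Set ℂ)ᶜ := V.finite_toSet.isClosed.isOpen_compl
  -- Removing finitely many points does not disconnect the plane, so vertices, where several links
  -- meet, need no local analysis.
  have hVconn : IsPreconnected (V : Set ℂ)ᶜ :=
    (V.countable_toSet.isConnected_compl_of_one_lt_rank (by
      rw [Complex.rank_real_complex]; norm_num)).isPreconnected
  have hVlines : ∀ w ∉ lines G, w ∉ V := by
    intro w hw hwV
    rw [hV, Finset.mem_union, Finset.mem_image, Finset.mem_image] at hwV
    rcases hwV with ⟨e, he, rfl⟩ | ⟨e, he, rfl⟩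
    · exact off subset_rfl hw (seg_subset_trace he (Link.left_mem_seg e))
    · exact off subset_rfl hw (seg_subset_trace he (Link.right_mem_seg e))
  have hfreq : ∀ x, ∃ᶠ w in 𝓝 x, w ∉ lines G := fun x =>
    mem_closure_iff_frequently.1 (dense_compl_lines h.plane.1 x)
  have hloc : ∀ z ∈ (V : Set ℂ)ᶜ, ∃ c, ∀ᶠ w in 𝓝 z, w ∉ lines G → F w = c := by
    intro z hzV
    by_cases hz : z ∈ trace G
    swap
    · have hopen : IsOpen (face G z) := (isClosed_trace G).isOpen_compl.connectedComponentIn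
      have hzS : ∀ {S : Finset Link}, S ⊆ G → z ∉ trace S := fun hS h' => hz (trace_mono hS h')
      refine ⟨F z, ?_⟩
      filter_upwards [hopen.mem_nhds (mem_connectedComponentIn hz),
        hIc.eventually_windingAround_eq (hzS hIG),
        h.circuit₁.eventually_windingAround_eq (hzS h.sub₁),
        h.circuit₂.eventually_windingAround_eq (hzS h.sub₂)] with w h0 h1 h2 h3 _
      simp only [hF, hκ, h1, h2, h3, hcol.1 z hz w h0]
    obtain ⟨e, he, hze⟩ := mem_trace.1 hz
    have hzo : z ∈ e.openSeg := by
      refine mem_openSegment_of_ne_left_right ?_ ?_ hze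
      · rintro rfl
        exact hzV (Finset.mem_union_left _ (Finset.mem_image_of_mem _ he))
      · rintro rfl
        exact hzV (Finset.mem_union_right _ (Finset.mem_image_of_mem _ he))
    obtain ⟨n, hn, -⟩ := h.plane.exists_windingAround_near_link hIc hIG he hzo
    obtain ⟨n₁, hn₁, hn₁'⟩ := h.plane.exists_windingAround_near_link h.circuit₁ h.sub₁ he hzo
    obtain ⟨n₂, hn₂, hn₂'⟩ := h.plane.exists_windingAround_near_link h.circuit₂ h.sub₂ he hzo
    set k : ℤ := if e ∈ I then 1 else 0 with hk
    set k₁ : ℤ := if e ∈ C₁ then 1 else 0 with hk₁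
    set k₂ : ℤ := if e ∈ C₂ then 1 else 0 with hk₂
    have hside := Link.side_eq_zero_of_mem_seg hze
    -- The constraints on each side are read off at a generic nearby point of that side.
    have hL : (n₁ + k₁ = 0 ∨ n₁ + k₁ = s₁) ∧ (n₂ + k₂ = 0 ∨ n₂ + k₂ = s₂) ∧
        (n₁ + k₁ ≠ 0 → n₂ + k₂ ≠ 0) := by
      obtain ⟨w, ⟨⟨hwl, hws⟩, h1⟩, h2⟩ := (((frequently_side_pos h.plane.1 he hside).and_eventually
        hn₁).and_eventually hn₂).exists
      have c₁ := b₁ w (off h.sub₁ hwl)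
      have c₂ := b₂ w (off h.sub₂ hwl)
      have c₃ := nest hwl
      rw [(h1 hwl).1 hws] at c₁ c₃
      rw [(h2 hwl).1 hws] at c₂ c₃
      exact ⟨by exact_mod_cast c₁, by exact_mod_cast c₂, by exact_mod_cast c₃⟩
    have hR : (n₁ = 0 ∨ n₁ = s₁) ∧ (n₂ = 0 ∨ n₂ = s₂) ∧ (n₁ ≠ 0 → n₂ ≠ 0) := by
      obtain ⟨w, ⟨⟨hwl, hws⟩, h1⟩, h2⟩ := (((frequently_side_neg h.plane.1 he hside).and_eventually
        hn₁).and_eventually hn₂).exists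
      have c₁ := b₁ w (off h.sub₁ hwl)
      have c₂ := b₂ w (off h.sub₂ hwl)
      have c₃ := nest hwl
      rw [(h1 hwl).2 hws] at c₁ c₃
      rw [(h2 hwl).2 hws] at c₂ c₃
      exact ⟨by exact_mod_cast c₁, by exact_mod_cast c₂, by exact_mod_cast c₃⟩
    have e₁ : k₁ = 0 ↔ e ∉ C₁ := by simp [hk₁]
    have e₂ : k₂ = 0 ↔ e ∉ C₂ := by simp [hk₂]
    have hmem : e ∈ I ↔ k₁ = 0 ∧ k₂ = 0 ∧ n₁ = 0 ∧ n₂ ≠ 0 := by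
      rw [hI, mem_interfaceGraph, e₁, e₂]
      constructor
      · rintro ⟨-, m₁, m₂, m₃, m₄⟩
        rw [Link.openSeg_subset_inside_iff (hn₁' m₁), not_not] at m₃
        rw [Link.openSeg_subset_outside_iff (hn₂' m₂)] at m₄
        exact ⟨m₁, m₂, m₃, m₄⟩
      · rintro ⟨m₁, m₂, m₃, m₄⟩
        refine ⟨he, m₁, m₂, ?_, ?_⟩
        · rwa [Link.openSeg_subset_inside_iff (hn₁' m₁), not_not]
        · rwa [Link.openSeg_subset_outside_iff (hn₂' m₂)]
    have harith := interface_jump_arith (k := k) hs₁ hs₂ (by rw [hk₁]; split_ifs <;> simp)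
      (by rw [hk₂]; split_ifs <;> simp) (by
        rw [e₁, e₂]
        by_contra! hc
        exact Finset.disjoint_left.1 h.disjoint hc.1 hc.2) hR.1 hR.2.1 hL.1 hL.2.1 hR.2.2 hL.2.2
      (by
        by_cases h' : e ∈ I
        · exact Or.inl ⟨by simp [hk, h'], hmem.1 h'⟩
        · exact Or.inr ⟨by simp [hk, h'], fun h'' => h' (hmem.2 h'')⟩)
    have harith' := congrArg (Int.cast : ℤ → ℝ) harith
    push_cast at harith'
    -- The value of `F` on the right of the link, where `κ = 0`.
    refine ⟨2 * n - (s₂ * n₂ * (0 - (1 + s₂)) - s₁ * n₁ * (0 - (1 - s₁))), ?_⟩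
    filter_upwards [hn, hn₁, hn₂, hcol.2 e he z hzo] with w g g₁ g₂ gc hwl
    have hws : e.side w ≠ 0 := fun h' => hwl ⟨e, he, h'⟩
    rcases lt_or_gt_of_ne hws with hs | hs
    · simp only [hF, hκ, (g hwl).2 hs, (g₁ hwl).2 hs, (g₂ hwl).2 hs, gc.2 hs]
      simp
    · simp only [hF, hκ, (g hwl).1 hs, (g₁ hwl).1 hs, (g₂ hwl).1 hs, gc.1 hs, if_true]
      push_cast
      linear_combination harith'
  obtain ⟨q, hq, hq₁, hq₂, hqI⟩ : ∃ q, q ∉ lines G ∧ windingAround C₁ q = 0 ∧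
      windingAround C₂ q = 0 ∧ windingAround I q = 0 := by
    have hinf := h.circuit₁.windingAround_eq_zero_near_infinity.and
      (h.circuit₂.windingAround_eq_zero_near_infinity.and hIc.windingAround_eq_zero_near_infinity)
    rw [← Metric.cobounded_eq_cocompact,
      (Metric.hasBasis_cobounded_compl_closedBall (0 : ℂ)).eventually_iff] at hinf
    obtain ⟨r, -, hr⟩ := hinf
    obtain ⟨x, hx⟩ := NormedSpace.exists_lt_norm ℝ ℂ r
    obtain ⟨q, hq, hqr⟩ := ((hfreq x).and_eventually
      (Metric.isClosed_closedBall.isOpen_compl.mem_nhds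
        (show x ∈ (Metric.closedBall (0 : ℂ) r)ᶜ by simpa using hx))).exists
    exact ⟨q, hq, (hr hqr).1.2, (hr hqr).2.1.2, (hr hqr).2.2.2⟩
  obtain ⟨y, ⟨⟨hy, hy₁⟩, hyI⟩⟩ := (((hfreq p).and_eventually
    (h.circuit₁.eventually_windingAround_eq hp.1)).and_eventually
    (hIc.eventually_windingAround_eq (h.notMem_trace_interfaceGraph hp))).exists
  have key := IsPreconnected.eq_of_eventually_const hVconn
    (fun x hx => by rw [hVopen.nhdsWithin_eq hx]; exact hfreq x)
    (fun x hx => by rw [hVopen.nhdsWithin_eq hx]; exact hloc x hx)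
    (show y ∈ (V : Set ℂ)ᶜ from hVlines y hy) hy (show q ∈ (V : Set ℂ)ᶜ from hVlines q hq) hq
  have hy₁0 : windingAround C₁ y ≠ 0 := hy₁ ▸ hp.2
  have v₁ := (b₁ y (off h.sub₁ hy)).resolve_left hy₁0
  have v₂ := (b₂ y (off h.sub₂ hy)).resolve_left (nest hy hy₁0)
  -- Inside both circuits the two indicators are 1 and the colour `κ y` cancels.
  simp only [hF, hq₁, hq₂, hqI, v₁, v₂, hyI] at key
  rcases hs₁ with rfl | rfl <;> rcases hs₂ with rfl | rfl <;> push_cast at key ⊢ <;> linarith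

/-! ### Decompositions into circuits -/

theorem windingAround_eq_sum_parts {L : Finset Link} (P : Finpartition L) (p : ℂ) :
    windingAround L p = ∑ S ∈ P.parts, windingAround S p := by
  classical
  have h : ∑ e ∈ P.parts.biUnion id, Complex.arg ((e.2 - p) / (e.1 - p)) =
      ∑ S ∈ P.parts, ∑ e ∈ S, Complex.arg ((e.2 - p) / (e.1 - p)) :=
    Finset.sum_biUnion P.disjoint
  rw [P.biUnion_parts] at h
  simp only [windingAround]
  rw [h, Finset.sum_div]

/-- A compensated remainder contributes nothing, so a chiral mode carries the whole winding number.
-/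
theorem windingAround_eq_of_decomposes {I S : Finset Link} (hS : S ⊆ I) {p : ℂ}
    (h : DecomposesWithoutSurrounding (I \ S) p) : windingAround I p = windingAround S p := by
  obtain ⟨P, hP⟩ := h
  have h0 : windingAround (I \ S) p = 0 := by
    rw [windingAround_eq_sum_parts P]
    exact Finset.sum_eq_zero fun S hS => (hP S hS).2
  have h1 : windingAround I p = windingAround (I \ S) p + windingAround S p := by
    simp only [windingAround]
    rw [← Finset.sum_sdiff hS, add_div]
  rw [h1, h0, zero_add]

theorem decomposesWithoutSurrounding_sdiff_self (I : Finset Link) (p : ℂ) :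
    DecomposesWithoutSurrounding (I \ I) p := by
  rw [Finset.sdiff_self]
  exact ⟨Finpartition.empty _, fun S hS => by simp at hS⟩

theorem IsCircuit.nonempty {S : Finset Link} (hS : IsCircuit S) : S.Nonempty := by
  obtain ⟨l, hl, -, rfl, -⟩ := hS
  simpa [List.toFinset_nonempty_iff] using hl

/-- Conversely `I` itself serves as the mode, with empty remainder. -/
theorem IsCircuit.hasChiralModeCCW_iff {I : Finset Link} (hI : IsCircuit I) (p : ℂ) :
    HasChiralModeCCW I p ↔ 0 < windingAround I p :=
  ⟨fun ⟨_, hS, hs, hd⟩ => windingAround_eq_of_decomposes hS hd ▸ hs.2,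
    fun h => ⟨I, subset_rfl, ⟨hI, h⟩, decomposesWithoutSurrounding_sdiff_self I p⟩⟩

theorem IsCircuit.hasChiralModeCW_iff {I : Finset Link} (hI : IsCircuit I) (p : ℂ) :
    HasChiralModeCW I p ↔ windingAround I p < 0 :=
  ⟨fun ⟨_, hS, hs, hd⟩ => windingAround_eq_of_decomposes hS hd ▸ hs.2,
    fun h => ⟨I, subset_rfl, ⟨hI, h⟩, decomposesWithoutSurrounding_sdiff_self I p⟩⟩

/-- The decomposition with the single part `I` gives one direction; in the other, a positive sum has
a positive term. -/
theorem IsCircuit.everyDecompositionCCW_iff {I : Finset Link} (hI : IsCircuit I) (p : ℂ) :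
    EveryDecompositionCCW I p ↔ 0 < windingAround I p := by
  constructor
  · intro h
    have := h (Finpartition.indiscrete hI.nonempty.ne_empty) (by simpa using hI)
    simpa [SurroundsCCW, hI] using this
  · intro h P hP
    by_contra! hc
    rw [windingAround_eq_sum_parts P] at h
    exact h.not_ge (Finset.sum_nonpos fun S hS => not_lt.1 fun h' => hc S hS ⟨hP S hS, h'⟩)

theorem IsCircuit.everyDecompositionCW_iff {I : Finset Link} (hI : IsCircuit I) (p : ℂ) :
    EveryDecompositionCW I p ↔ windingAround I p < 0 := by
  constructor
  · intro h
    have := h (Finpartition.indiscrete hI.nonempty.ne_empty) (by simpa using hI)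
    simpa [SurroundsCW, hI] using this
  · intro h P hP
    by_contra! hc
    rw [windingAround_eq_sum_parts P] at h
    exact h.not_ge (Finset.sum_nonneg fun S hS => not_lt.1 fun h' => hc S hS ⟨hP S hS, h'⟩)

/-- The winding number of the interface is determined by the orientations of the two circuits. -/
theorem IsNestedSplitting.exists_windingAround_eq {G C₁ C₂ : Finset Link}
    (h : IsNestedSplitting G C₁ C₂) {p : ℂ} (hp : p ∈ inside C₁) :
    ∃ W : ℤ, windingAround (interfaceGraph G C₁ C₂) p = W ∧ (W = 0 ∨ W = 1 ∨ W = -1) ∧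
      (W = 0 ↔ OppositeOrientations C₁ C₂) := by
  have hp₂ := h.nested hp
  -- The two orientations exclude each other because the winding number at `p` is nonzero.
  have x₁ : ¬ (BoundsCCW C₁ ∧ BoundsCW C₁) := fun ⟨ha, hb⟩ => by
    have ha := (ha p hp.1).resolve_left hp.2
    have hb := (hb p hp.1).resolve_left hp.2
    linarith
  have x₂ : ¬ (BoundsCCW C₂ ∧ BoundsCW C₂) := fun ⟨ha, hb⟩ => by
    have ha := (ha p hp₂.1).resolve_left hp₂.2
    have hb := (hb p hp₂.1).resolve_left hp₂.2
    linarith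
  have ccw : ∀ {S : Finset Link}, BoundsCCW S →
      ∀ w ∉ trace S, windingAround S w = 0 ∨ windingAround S w = (1 : ℤ) := fun hS => by
    simpa [BoundsCCW] using hS
  have cw : ∀ {S : Finset Link}, BoundsCW S →
      ∀ w ∉ trace S, windingAround S w = 0 ∨ windingAround S w = (-1 : ℤ) := fun hS => by
    simpa [BoundsCW] using hS
  unfold OppositeOrientations
  rcases h.bounds₁ with h₁ | h₁ <;> rcases h.bounds₂ with h₂ | h₂
  · have hw := h.two_mul_windingAround (Or.inl rfl) (Or.inl rfl) (ccw h₁) (ccw h₂) hp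
    exact ⟨-1, by push_cast at hw ⊢; linarith, by simp, by simp; tauto⟩
  · have hw := h.two_mul_windingAround (Or.inl rfl) (Or.inr rfl) (ccw h₁) (cw h₂) hp
    exact ⟨0, by push_cast at hw ⊢; linarith, by simp, by simp; tauto⟩
  · have hw := h.two_mul_windingAround (Or.inr rfl) (Or.inl rfl) (cw h₁) (ccw h₂) hp
    exact ⟨0, by push_cast at hw ⊢; linarith, by simp, by simp; tauto⟩
  · have hw := h.two_mul_windingAround (Or.inr rfl) (Or.inr rfl) (cw h₁) (cw h₂) hp
    exact ⟨1, by push_cast at hw ⊢; linarith, by simp, by simp; tauto⟩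

end PlaneNetwork

/-! ### The main theorem -/

open PlaneNetwork
theorem mainTheorem4 (G C₁ C₂ : Finset Link) (h : IsNestedSplitting G C₁ C₂)
    (p : ℂ) (hp : p ∈ inside C₁) :
    ∃ W : ℤ, IsGraphWindingNumber (interfaceGraph G C₁ C₂) p W ∧
      (HasChiralModeCCW (interfaceGraph G C₁ C₂) p ↔ W = 1) ∧
      (HasChiralModeCW (interfaceGraph G C₁ C₂) p ↔ W = -1) ∧
      (EveryDecompositionCCW (interfaceGraph G C₁ C₂) p ↔ W = 1) ∧
      (EveryDecompositionCW (interfaceGraph G C₁ C₂) p ↔ W = -1) ∧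
      (W = 0 ↔ ¬ HasChiralModeCCW (interfaceGraph G C₁ C₂) p ∧
        ¬ HasChiralModeCW (interfaceGraph G C₁ C₂) p) ∧
      (W = 0 ↔ OppositeOrientations C₁ C₂) := by
  obtain ⟨W, hW, hW', hop⟩ := h.exists_windingAround_eq hp
  have hI : IsCircuit (interfaceGraph G C₁ C₂) := h.interface_eulerian
  have hplane := h.plane.mono (interfaceGraph_subset G C₁ C₂)
  have hpI := h.notMem_trace_interfaceGraph hp
  refine ⟨W, ⟨exists_isSemiInfiniteLine hpI, fun γ hγ => ?_⟩, ?_, ?_, ?_, ?_, ?_, hop⟩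
  · have := hγ.signedCrossings_eq hplane hI hpI
    rw [hW] at this
    exact_mod_cast this
  -- Since `W` is 0, 1 or -1, its sign determines it.
  · rw [hI.hasChiralModeCCW_iff, hW, Int.cast_pos]; omega
  · rw [hI.hasChiralModeCW_iff, hW, Int.cast_lt_zero]; omega
  · rw [hI.everyDecompositionCCW_iff, hW, Int.cast_pos]; omega
  · rw [hI.everyDecompositionCW_iff, hW, Int.cast_lt_zero]; omega
  · rw [hI.hasChiralModeCCW_iff, hI.hasChiralModeCW_iff, hW, Int.cast_pos, Int.cast_lt_zero]
    omega
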